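/- **Theorem 4.1.** Let $p\in[0,1]$ and consider the simple exclusion process on $\mathbb{Z}$ in which each particle attempts to jump one site to the right at rate $p$ and one site to the left at rate $1-p$, an attempt succeeding if and only if the target site is empty. Let $O$ be the configuration in which every negative site is occupied and every non-negative site is empty. Write $\mathbb{P}_p$ for the law of the process $(X_s)_{s\ge 0}$ with parameter $p$ started from $X_0=O$; it is the continuous-time Markov chain with these jump rates on the countable set of configurations that have finitely many particles in $[0,\infty)$ and equally many holes in $(-\infty,0)$. Then, for every $t\ge 0$: (a) $\mathbb{P}_p(X_t=O)=e^{-(2p-1)t}\,\mathbb{P}_{1-p}(X_t=O)$. (b) $\mathbb{P}_p(X_t=O)>0$, and, conditioned on the event $X_t=O$, the processes with parameters $p$ and $1-p$ have identical laws on $[0,t]$: the conditional law of $(X_s)_{0\le s\le t}$ given $X_t=O$, on path space with the product $\sigma$-algebra, is the same under $\mathbb{P}_p$ as under $\mathbb{P}_{1-p}$. -/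

import Mathlib

open MeasureTheory ProbabilityTheory
open scoped NNReal ENNReal

noncomputable section

namespace Exclusion

/-- The countable state space of the exclusion process: a configuration is the set of occupied
sites of `ℤ`; the number of particles in `[0, ∞)` is finite and equal to the number of holes
in `(-∞, 0)`. -/
def State : Type :=
  {x : Set ℤ // {i : ℤ | 0 ≤ i ∧ i ∈ x}.Finite ∧ {i : ℤ | i < 0 ∧ i ∉ x}.Finite ∧
    {i : ℤ | 0 ≤ i ∧ i ∈ x}.ncard = {i : ℤ | i < 0 ∧ i ∉ x}.ncard}

/-- States carry the discrete σ-algebra. -/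
instance : MeasurableSpace State := ⊤

instance : DiscreteMeasurableSpace State := ⟨fun _ => trivial⟩

/-- States together with a cemetery point `none`, with the discrete σ-algebra. -/
instance : MeasurableSpace (Option State) := ⊤

instance : DiscreteMeasurableSpace (Option State) := ⟨fun _ => trivial⟩

/-- The state `O`: every negative site is occupied, every non-negative site is empty. -/
def origin : State :=
  ⟨{i : ℤ | i < 0}, by
    have h1 : {i : ℤ | 0 ≤ i ∧ i ∈ {i : ℤ | i < 0}} = ∅ := by
      ext i; simp
    have h2 : {i : ℤ | i < 0 ∧ i ∉ {i : ℤ | i < 0}} = ∅ := by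
      ext i; simp
    rw [h1, h2]; simp⟩

/-- `y` is obtained from `x` when the particle at site `i` jumps to the empty site `j`. -/
def IsJump (x y : State) (i j : ℤ) : Prop :=
  i ∈ x.1 ∧ j ∉ x.1 ∧ y.1 = insert j (x.1 \ {i})

open Classical in
/-- The rate of the transition from `x` to `y`: each particle jumps one site to the right at
rate `p` and one site to the left at rate `1 - p`, provided that the target site is empty. -/
def rate (p : ℝ) (x y : State) : ℝ≥0∞ :=
  (if ∃ i, IsJump x y i (i + 1) then ENNReal.ofReal p else 0) +
    (if ∃ i, IsJump x y i (i - 1) then ENNReal.ofReal (1 - p) else 0)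

/-- The total rate of jumps out of `x`. -/
def totalRate (p : ℝ) (x : State) : ℝ≥0∞ := ∑' y, rate p x y

lemma finite_isJump (x : State) (a : ℤ) (ha : a = 1 ∨ a = -1) :
    {y : State | ∃ i, IsJump x y i (i + a)}.Finite := by
  have hfin : {i : ℤ | i ∈ x.1 ∧ i + a ∉ x.1}.Finite := by
    refine ((x.2.1.union (x.2.2.1.image (fun i => i - a))).union
      (Set.finite_Icc (-1 : ℤ) 1)).subset ?_
    rintro i ⟨h1, h2⟩
    by_cases hi : 0 ≤ i
    · exact Or.inl (Or.inl ⟨hi, h1⟩)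
    · by_cases hj : i + a < 0
      · exact Or.inl (Or.inr ⟨i + a, ⟨hj, h2⟩, by simp⟩)
      · refine Or.inr ⟨?_, ?_⟩ <;> omega
  have himg : (Subtype.val '' {y : State | ∃ i, IsJump x y i (i + a)}).Finite := by
    refine (hfin.image (fun i => insert (i + a) (x.1 \ {i}))).subset ?_
    rintro _ ⟨y, ⟨i, h1, h2, h3⟩, rfl⟩
    exact ⟨i, ⟨h1, h2⟩, h3.symm⟩
  exact Set.Finite.of_finite_image himg Subtype.val_injective.injOn

open Classical in
/-- The total jump rate out of a state is finite. -/
lemma totalRate_ne_top (p : ℝ) (x : State) : totalRate p x ≠ ∞ := by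
  have h1 := finite_isJump x 1 (Or.inl rfl)
  have h2 : {y : State | ∃ i, IsJump x y i (i - 1)}.Finite := by
    simpa [sub_eq_add_neg] using finite_isJump x (-1) (Or.inr rfl)
  have hs : ∀ y ∉ (h1.toFinset ∪ h2.toFinset), rate p x y = 0 := by
    intro y hy
    simp only [Finset.mem_union, Set.Finite.mem_toFinset,
      Set.mem_ofPred_eq, not_or] at hy
    simp [rate, hy.1, hy.2]
  rw [totalRate, tsum_eq_sum hs]
  refine ENNReal.sum_ne_top.2 fun y _ => ?_
  unfold rate
  split_ifs <;> simp

open Classical in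
/-- The law of the next state of the embedded jump chain: from `x` it goes to `y` with
probability `rate p x y / totalRate p x`; an absorbing state is never left. -/
def stepMeasure (p : ℝ) (x : State) : Measure State :=
  if totalRate p x = 0 then Measure.dirac x
  else (totalRate p x)⁻¹ • Measure.sum fun y => rate p x y • Measure.dirac y

/-- The transition kernel of the embedded jump chain. -/
def stepKernel (p : ℝ) : Kernel State State where
  toFun := stepMeasure p
  measurable' := Measurable.of_discrete

instance (p : ℝ) : IsMarkovKernel (stepKernel p) := by
  refine ⟨fun x => ⟨?_⟩⟩
  change stepMeasure p x Set.univ = 1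
  by_cases h : totalRate p x = 0
  · simp [stepMeasure, h]
  · simp only [stepMeasure, h, if_false, Measure.smul_apply,
      Measure.sum_apply _ MeasurableSet.univ, measure_univ, smul_eq_mul, mul_one]
    exact ENNReal.inv_mul_cancel h (totalRate_ne_top p x)

/-- The law of the embedded jump chain started from `O`. -/
def chainMeasure (p : ℝ) : Measure (ℕ → State) :=
  Kernel.trajMeasure (X := fun _ => State) (Measure.dirac origin) fun n =>
    (stepKernel p).comap (fun h : (i : Finset.Iic n) → State => h ⟨n, by simp⟩)
      (measurable_pi_apply _)

instance : IsProbabilityMeasure (expMeasure 1) := isProbabilityMeasure_expMeasure one_pos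

/-- The sample space: the states visited in turn, and a sequence of exponential clocks. -/
abbrev Sample : Type := (ℕ → State) × (ℕ → ℝ)

/-- The law of the jump chain of the process with parameter `p` started from `O`, together with
an independent sequence of independent exponential variables of mean `1`. -/
def P (p : ℝ) : Measure Sample :=
  (chainMeasure p).prod (Measure.infinitePi fun _ : ℕ => expMeasure 1)

instance (p : ℝ) : IsProbabilityMeasure (P p) := by
  unfold P chainMeasure; infer_instance

/-- The time of the `n`-th jump: the holding time in the `k`-th visited state `x` is the `k`-th
exponential variable divided by `totalRate p x`, hence exponential of rate `totalRate p x`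
(infinite if `x` is absorbing). -/
def jumpTime (p : ℝ) (n : ℕ) (ω : Sample) : ℝ≥0∞ :=
  ∑ k ∈ Finset.range n, ENNReal.ofReal (ω.2 k) / totalRate p (ω.1 k)

open Classical in
/-- The state at time `t` of the exclusion process with parameter `p` started from `O`: it is the
`n`-th visited state while `jumpTime p n ≤ t < jumpTime p (n + 1)`, and it is the cemetery
`none` from the time on at which jumps accumulate. -/
def X (p : ℝ) (t : ℝ≥0) (ω : Sample) : Option State :=
  if h : ∃ n, (t : ℝ≥0∞) < jumpTime p (n + 1) ω then some (ω.1 (Nat.find h)) else none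

/-- The path of the process on the time interval `[0, t]`. -/
def path (p : ℝ) (t : ℝ≥0) (ω : Sample) : Set.Icc (0 : ℝ≥0) t → Option State :=
  fun s => X p s ω

lemma measurable_jumpTime (p : ℝ) (n : ℕ) : Measurable (jumpTime p n) := by
  refine Finset.measurable_sum _ fun k _ => Measurable.div ?_ ?_
  · exact ENNReal.measurable_ofReal.comp ((measurable_pi_apply k).comp measurable_snd)
  · exact (Measurable.of_discrete (f := totalRate p)).comp
      ((measurable_pi_apply k).comp measurable_fst)

open Classical in
lemma measurable_X (p : ℝ) (t : ℝ≥0) : Measurable (X p t) := by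
  have hm : ∀ n, MeasurableSet {ω | (t : ℝ≥0∞) < jumpTime p (n + 1) ω} := fun n =>
    measurableSet_lt measurable_const (measurable_jumpTime p (n + 1))
  have hE : MeasurableSet {ω : Sample | ∃ n, (t : ℝ≥0∞) < jumpTime p (n + 1) ω} := by
    simp only [Set.ofPred_exists]; exact MeasurableSet.iUnion hm
  have hfind : Measurable fun ω : {ω : Sample | ∃ n, (t : ℝ≥0∞) < jumpTime p (n + 1) ω} =>
      (ω : Sample).1 (Nat.find ω.2) := by
    have := Measurable.find
      (f := fun n (ω : {ω : Sample | ∃ n, (t : ℝ≥0∞) < jumpTime p (n + 1) ω}) => (ω : Sample).1 n)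
      (p := fun n ω => (t : ℝ≥0∞) < jumpTime p (n + 1) (ω : Sample))
      (fun n => (measurable_pi_apply n).comp (measurable_fst.comp measurable_subtype_coe))
      (fun n => measurable_subtype_coe (hm n)) (fun ω => ω.2)
    exact this
  refine Measurable.dite
    (f := fun ω : {ω : Sample | ∃ n, (t : ℝ≥0∞) < jumpTime p (n + 1) ω} =>
      some ((ω : Sample).1 (Nat.find ω.2))) (g := fun _ => none)
    ((Measurable.of_discrete (f := (some : State → Option State))).comp hfind)
    measurable_const hE

lemma measurable_path (p : ℝ) (t : ℝ≥0) : Measurable (path p t) :=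
  measurable_pi_lambda _ fun s => measurable_X p s

/-- The event that the process is in state `O` at time `t`. -/
def returnEvent (p : ℝ) (t : ℝ≥0) : Set Sample := {ω | X p t ω = some origin}

/-- The law, under the product σ-algebra, of the path on `[0, t]` of the process with
parameter `p`, conditioned on being in state `O` at time `t`. -/
def bridgeLaw (p : ℝ) (t : ℝ≥0) : Measure (Set.Icc (0 : ℝ≥0) t → Option State) :=
  (cond (P p) (returnEvent p t)).map (path p t)

end Exclusion

end

/-!
In every configuration exactly one more particle can jump to the right than to the left, because
the occupation variable goes from `1` far to the left to `0` far to the right. If `ℓ` particles can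
jump to the left, the total rate out of the configuration is therefore
`p (ℓ + 1) + (1 - p) ℓ = ℓ + p` (`totalRate_eq`). It depends on `p` only through a constant shift.

The process follows given states `a 0, …, a n` up to time `t`, with holding times `τ k` for `k < n`,
with density `∏ rate p (a k) (a (k + 1)) * exp (-∑ (ℓ k + p) τ k - (ℓ n + p) (t - ∑ τ k))`: the total
rates in the densities of the holding times cancel those in the transition probabilities of the
jump chain. The holding times add up to `t`, so the density is `exp (-p t)` times the product of
the rates times a factor that does not involve `p` (`P_pathEvent`). If the path leads from `O` to
`O`, then it has as many jumps to the right as to the left, since each jump moves the sum of the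
positions of the particles by one; hence the product of the rates is `(p (1 - p)) ^ (n / 2)`, or `0`
for both parameters, and it is unchanged when `p` is replaced by `1 - p` (`prod_rate_one_sub`).

Summing over the countably many paths that return to `O`, the path measures with parameters `p` and
`1 - p`, restricted to the event of a return at time `t`, are proportional with the factor
`exp (-p t) / exp (-(1 - p) t) = exp (-(2 p - 1) t)` (`P_returnEvent_inter`). The total masses give
the first assertion, and normalization removes the factor.

No non-explosion estimate is needed, as there are only finitely many jumps up to time `t` on the
event of a return. An absorbing state, whose total rate `ℓ + p` is `0`, occurs for parameter `0`
only: paths that are to leave one have weight `0`, and as the last state of a path it is covered by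
the same formula, with an infinite holding time.
-/

namespace Exclusion

/-! ### Configurations and jumps -/

/-- A configuration is encoded by the finite set of sites where it differs from `O`. -/
instance : Countable State := by
  have hfin : ∀ x : State, (symmDiff x.1 origin.1).Finite := fun x => by
    refine (x.2.1.union x.2.2.1).subset ?_
    intro i hi
    simp only [origin, Set.mem_symmDiff, Set.mem_ofPred_eq, not_lt] at hi
    exact hi.imp (fun h => ⟨h.2, h.1⟩) id
  have hinj : Function.Injective fun x : State => (hfin x).toFinset := by
    intro x y hxy
    exact Subtype.ext (symmDiff_left_injective _ (Set.Finite.toFinset_inj.1 hxy))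
  exact hinj.countable

lemma exists_isJump (x : State) {i j : ℤ} (hi : i ∈ x.1) (hj : j ∉ x.1) :
    ∃ y, IsJump x y i j := by
  have hij : i ≠ j := fun h => hj (h ▸ hi)
  obtain ⟨hA, hB, hAB⟩ := x.2
  set A := {k : ℤ | 0 ≤ k ∧ k ∈ x.1}
  set B := {k : ℤ | k < 0 ∧ k ∉ x.1}
  suffices H : ∃ A' B' : Set ℤ, A' = {k : ℤ | 0 ≤ k ∧ k ∈ insert j (x.1 \ {i})} ∧
      B' = {k : ℤ | k < 0 ∧ k ∉ insert j (x.1 \ {i})} ∧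
      A'.Finite ∧ B'.Finite ∧ A'.ncard = B'.ncard by
    obtain ⟨A', B', rfl, rfl, h⟩ := H
    exact ⟨⟨insert j (x.1 \ {i}), h⟩, hi, hj, rfl⟩
  rcases le_or_gt 0 i with hi0 | hi0 <;> rcases le_or_gt 0 j with hj0 | hj0
  · refine ⟨insert j (A \ {i}), B, ?_, ?_, hA.sdiff.insert j, hB, ?_⟩
    · ext k; simp only [A, Set.mem_insert_iff, Set.mem_sdiff, Set.mem_ofPred_eq,
        Set.mem_singleton_iff]; grind
    · ext k; simp only [B, Set.mem_insert_iff, Set.mem_sdiff, Set.mem_ofPred_eq,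
        Set.mem_singleton_iff]; grind
    · rw [Set.ncard_exchange (fun h : j ∈ A => hj h.2) (show i ∈ A from ⟨hi0, hi⟩), hAB]
  · refine ⟨A \ {i}, B \ {j}, ?_, ?_, hA.sdiff, hB.sdiff, ?_⟩
    · ext k; simp only [A, Set.mem_insert_iff, Set.mem_sdiff, Set.mem_ofPred_eq,
        Set.mem_singleton_iff]; grind
    · ext k; simp only [B, Set.mem_insert_iff, Set.mem_sdiff, Set.mem_ofPred_eq,
        Set.mem_singleton_iff]; grind
    · rw [Set.ncard_sdiff_singleton_of_mem (show i ∈ A from ⟨hi0, hi⟩),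
        Set.ncard_sdiff_singleton_of_mem (show j ∈ B from ⟨hj0, hj⟩), hAB]
  · refine ⟨insert j A, insert i B, ?_, ?_, hA.insert j, hB.insert i, ?_⟩
    · ext k; simp only [A, Set.mem_insert_iff, Set.mem_sdiff, Set.mem_ofPred_eq,
        Set.mem_singleton_iff]; grind
    · ext k; simp only [B, Set.mem_insert_iff, Set.mem_sdiff, Set.mem_ofPred_eq,
        Set.mem_singleton_iff]; grind
    · rw [Set.ncard_insert_of_notMem (fun h => hj h.2) hA,
        Set.ncard_insert_of_notMem (fun h => h.2 hi) hB, hAB]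
  · refine ⟨A, insert i (B \ {j}), ?_, ?_, hA, hB.sdiff.insert i, ?_⟩
    · ext k; simp only [A, Set.mem_insert_iff, Set.mem_sdiff, Set.mem_ofPred_eq,
        Set.mem_singleton_iff]; grind
    · ext k; simp only [B, Set.mem_insert_iff, Set.mem_sdiff, Set.mem_ofPred_eq,
        Set.mem_singleton_iff]; grind
    · rw [Set.ncard_exchange (fun h : i ∈ B => h.2 hi) (show j ∈ B from ⟨hj0, hj⟩), hAB]

lemma IsJump.sites_eq {x y : State} {i j i' j' : ℤ} (h : IsJump x y i j)
    (h' : IsJump x y i' j') : i = i' ∧ j = j' := by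
  obtain ⟨h1, h2, h3⟩ := h
  obtain ⟨h1', h2', h3'⟩ := h'
  rw [h3, Set.ext_iff] at h3'
  have hi := h3' i
  have hj := h3' j
  simp only [Set.mem_insert_iff, Set.mem_sdiff, Set.mem_singleton_iff] at hi hj
  grind

lemma not_isJump_right_and_left {x y : State} (hr : ∃ i, IsJump x y i (i + 1))
    (hl : ∃ i, IsJump x y i (i - 1)) : False := by
  obtain ⟨i, hi⟩ := hr
  obtain ⟨j, hj⟩ := hl
  have := hi.sites_eq hj
  omega

/-- The configurations reached by a jump of displacement `a` correspond to the particles that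
can make it. -/
lemma encard_isJump (x : State) (a : ℤ) :
    {y : State | ∃ i, IsJump x y i (i + a)}.encard = {i : ℤ | i ∈ x.1 ∧ i + a ∉ x.1}.encard := by
  have hex : ∀ i, ∃ y, i ∈ {i : ℤ | i ∈ x.1 ∧ i + a ∉ x.1} → IsJump x y i (i + a) := fun i => by
    by_cases hi : i ∈ {i : ℤ | i ∈ x.1 ∧ i + a ∉ x.1}
    · obtain ⟨y, hy⟩ := exists_isJump x hi.1 hi.2
      exact ⟨y, fun _ => hy⟩
    · exact ⟨x, fun h => absurd h hi⟩
  choose f hf using hex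
  have hinj : Set.InjOn f {i : ℤ | i ∈ x.1 ∧ i + a ∉ x.1} := fun i hi j hj hij =>
    ((hf i hi).sites_eq (hij ▸ hf j hj)).1
  rw [← hinj.encard_image]
  congr 1
  ext y
  refine ⟨?_, ?_⟩
  · rintro ⟨i, hi⟩
    exact ⟨i, ⟨hi.1, hi.2.1⟩, Subtype.ext ((hf i ⟨hi.1, hi.2.1⟩).2.2.trans hi.2.2.symm)⟩
  · rintro ⟨i, hi, rfl⟩
    exact ⟨i, hf i hi⟩

/-- The number of particles with an empty site on their left. -/
noncomputable def leftMoves (x : State) : ℕ := {i : ℤ | i ∈ x.1 ∧ i + -1 ∉ x.1}.ncard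

lemma encard_left (x : State) : {i : ℤ | i ∈ x.1 ∧ i + -1 ∉ x.1}.encard = leftMoves x := by
  refine (Set.Finite.cast_ncard_eq ?_).symm
  rw [← Set.encard_lt_top_iff, ← encard_isJump, Set.encard_lt_top_iff]
  exact finite_isJump x (-1) (Or.inr rfl)

open Classical in
/-- Reading the sites from left to right, the occupation variable goes from `1` to `0`, so it
steps down once more than it steps up. -/
lemma encard_right (x : State) :
    {i : ℤ | i ∈ x.1 ∧ i + 1 ∉ x.1}.encard = leftMoves x + 1 := by
  obtain ⟨b, hb⟩ := x.2.1.bddAbove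
  obtain ⟨c, hc⟩ := x.2.2.1.bddBelow
  have hpos : ∀ i ∈ x.1, i ≤ b ∨ i < 0 := fun i h => by
    by_contra! h'
    exact h'.1.not_ge (hb ⟨h'.2, h⟩)
  have hneg : ∀ i ∉ x.1, c ≤ i ∨ 0 ≤ i := fun i h => by
    by_contra! h'
    exact h'.1.not_ge (hc ⟨h'.2, h⟩)
  -- All changes of the occupation variable take place between `s` and `s + m`.
  set s : ℤ := min c 0 - 1
  obtain ⟨m, hm⟩ : ∃ m : ℕ, s + m = max b 0 + 1 := ⟨(max b 0 + 1 - s).toNat, by omega⟩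
  set f : ℕ → ℤ := fun k => if s + k ∈ x.1 then 1 else 0
  have hR : {i : ℤ | i ∈ x.1 ∧ i + 1 ∉ x.1} = (fun k : ℕ => s + k) ''
      (({k ∈ Finset.range m | s + (k : ℤ) ∈ x.1 ∧ s + (k : ℤ) + 1 ∉ x.1} :
        Finset ℕ) : Set ℕ) := by
    ext i
    simp only [Set.mem_ofPred_eq, Set.mem_image, Finset.coe_filter, Finset.mem_range]
    refine ⟨fun ⟨h1, h2⟩ => ⟨(i - s).toNat, ?_⟩, ?_⟩
    · have h3 := hpos i h1
      have h4 := hneg (i + 1) h2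
      have h5 : s + ((i - s).toNat : ℤ) = i := by omega
      rw [h5]
      exact ⟨⟨by omega, h1, h2⟩, rfl⟩
    · rintro ⟨k, ⟨-, h⟩, rfl⟩
      exact h
  have hL : {i : ℤ | i ∈ x.1 ∧ i + -1 ∉ x.1} = (fun k : ℕ => s + k + 1) ''
      (({k ∈ Finset.range m | s + (k : ℤ) ∉ x.1 ∧ s + (k : ℤ) + 1 ∈ x.1} :
        Finset ℕ) : Set ℕ) := by
    ext i
    simp only [Set.mem_ofPred_eq, Set.mem_image, Finset.coe_filter, Finset.mem_range]
    refine ⟨fun ⟨h1, h2⟩ => ⟨(i + -1 - s).toNat, ?_⟩, ?_⟩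
    · have h3 := hpos i h1
      have h4 := hneg (i + -1) h2
      have h5 : s + ((i + -1 - s).toNat : ℤ) = i + -1 := by omega
      rw [h5, neg_add_cancel_right]
      exact ⟨⟨by omega, h2, h1⟩, rfl⟩
    · rintro ⟨k, ⟨-, h⟩, rfl⟩
      rw [add_neg_cancel_right]
      exact h.symm
  have hsum : ∑ k ∈ Finset.range m, (f k - f (k + 1)) = 1 := by
    rw [Finset.sum_range_sub']
    have h0 : s + (0 : ℕ) ∈ x.1 := by
      by_contra h
      have := hneg _ h
      omega
    have h1 : s + m ∉ x.1 := fun h => by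
      have := hpos _ h
      omega
    simp only [f, if_pos h0, if_neg h1, sub_zero]
  have hstep : ∀ k, f k - f (k + 1) = (if s + (k : ℤ) ∈ x.1 ∧ s + (k : ℤ) + 1 ∉ x.1 then 1 else 0) -
      if s + (k : ℤ) ∉ x.1 ∧ s + (k : ℤ) + 1 ∈ x.1 then 1 else 0 := fun k => by
    simp only [f, Nat.cast_add, Nat.cast_one, ← add_assoc]
    by_cases h1 : s + (k : ℤ) ∈ x.1 <;> by_cases h2 : s + (k : ℤ) + 1 ∈ x.1 <;> simp [h1, h2]
  simp only [hstep, Finset.sum_sub_distrib, Finset.sum_boole] at hsum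
  rw [← encard_left, hR, hL, Function.Injective.encard_image (fun a b h => by simpa using h),
    Function.Injective.encard_image (fun a b h => by simpa using h), Set.encard_coe_eq_coe_finsetCard,
    Set.encard_coe_eq_coe_finsetCard]
  norm_cast
  omega

lemma totalRate_eq_encard (p : ℝ) (x : State) :
    totalRate p x = {i : ℤ | i ∈ x.1 ∧ i + 1 ∉ x.1}.encard * ENNReal.ofReal p +
      {i : ℤ | i ∈ x.1 ∧ i + -1 ∉ x.1}.encard * ENNReal.ofReal (1 - p) := by
  classical
  have key : ∀ (s : Set State) (c : ℝ≥0∞), ∑' y, (if y ∈ s then c else 0) = s.encard * c := by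
    intro s c
    rw [← ENNReal.tsum_set_const, tsum_subtype s fun _ => c]
    rfl
  unfold totalRate rate
  rw [ENNReal.tsum_add, ← encard_isJump, ← encard_isJump, ← key, ← key]
  rfl

lemma totalRate_eq {p : ℝ} (hp0 : 0 ≤ p) (hp1 : p ≤ 1) (x : State) :
    totalRate p x = ENNReal.ofReal (leftMoves x + p) := by
  rw [totalRate_eq_encard, encard_right, encard_left]
  have h1 : (((leftMoves x + 1 : ℕ∞) : ℝ≥0∞)) = ENNReal.ofReal (leftMoves x + 1) := by
    rw [ENNReal.ofReal_add (by positivity) one_pos.le]; simp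
  have h2 : (((leftMoves x : ℕ∞) : ℝ≥0∞)) = ENNReal.ofReal (leftMoves x) := by
    simp
  rw [h1, h2, ← ENNReal.ofReal_mul (by positivity), ← ENNReal.ofReal_mul (by positivity),
    ← ENNReal.ofReal_add (by positivity) (mul_nonneg (by positivity) (by linarith))]
  congr 1
  ring

/-! ### Weights of closed paths -/

open Classical in
/-- The sum of the positions of the particles, counted relative to `O`. -/
noncomputable def momentum (x : State) : ℤ :=
  ∑ᶠ i : ℤ, i * ((if i ∈ x.1 then 1 else 0) - if i < 0 then 1 else 0)

open Classical in
lemma momentum_of_isJump {x y : State} {i j : ℤ} (h : IsJump x y i j) :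
    momentum y - momentum x = j - i := by
  have hfin : ∀ x : State, (Function.support fun i : ℤ =>
      i * ((if i ∈ x.1 then 1 else 0) - if i < 0 then 1 else 0)).Finite := fun x => by
    refine (x.2.1.union x.2.2.1).subset ?_
    intro k hk
    simp only [Function.mem_support] at hk
    by_cases h1 : k ∈ x.1 <;> by_cases h2 : k < 0 <;> simp_all
  have hij : i ≠ j := fun e => h.2.1 (e ▸ h.1)
  unfold momentum
  rw [← finsum_sub_distrib (hfin y) (hfin x), finsum_eq_sum_of_support_subset (s := {i, j})]
  · obtain ⟨h1, h2, h3⟩ := h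
    rw [Finset.sum_pair hij, h3]
    simp only [h1, h2, hij, Set.mem_insert_iff, Set.mem_sdiff, Set.mem_singleton_iff, if_true,
      if_false, true_or, false_or, not_true, and_false]
    ring
  · intro k hk
    obtain ⟨h1, h2, h3⟩ := h
    simp only [Function.mem_support, h3, Set.mem_insert_iff, Set.mem_sdiff,
      Set.mem_singleton_iff] at hk
    simp only [Finset.coe_insert, Finset.coe_singleton, Set.mem_insert_iff,
      Set.mem_singleton_iff]
    by_contra hc
    simp only [not_or] at hc
    simp [hc.1, hc.2] at hk

/-- The rates along a path multiply to `p ^ a * (1 - p) ^ b`, where `a` and `b` count the jumps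
to the right and to the left, unless the path contains a forbidden transition. -/
lemma prod_rate_eq_zero_or (x : ℕ → State) (n : ℕ) :
    (∀ p, ∏ k ∈ Finset.range n, rate p (x k) (x (k + 1)) = 0) ∨
      ∃ a b : ℕ, (a : ℤ) - b = momentum (x n) - momentum (x 0) ∧
        ∀ p, ∏ k ∈ Finset.range n, rate p (x k) (x (k + 1)) =
          ENNReal.ofReal p ^ a * ENNReal.ofReal (1 - p) ^ b := by
  induction n with
  | zero => exact Or.inr ⟨0, 0, by simp, by simp⟩
  | succ n ih =>
    rcases ih with h | ⟨a, b, hab, h⟩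
    · exact Or.inl fun p => by rw [Finset.prod_range_succ, h, zero_mul]
    by_cases hr : ∃ i, IsJump (x n) (x (n + 1)) i (i + 1)
    · have hl : ¬ ∃ i, IsJump (x n) (x (n + 1)) i (i - 1) := fun hl =>
        not_isJump_right_and_left hr hl
      refine Or.inr ⟨a + 1, b, ?_, fun p => ?_⟩
      · obtain ⟨i, hi⟩ := hr
        have := momentum_of_isJump hi
        push_cast
        linarith
      · rw [Finset.prod_range_succ, h, rate, if_pos hr, if_neg hl]
        ring
    · by_cases hl : ∃ i, IsJump (x n) (x (n + 1)) i (i - 1)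
      · refine Or.inr ⟨a, b + 1, ?_, fun p => ?_⟩
        · obtain ⟨i, hi⟩ := hl
          have := momentum_of_isJump hi
          push_cast
          linarith
        · rw [Finset.prod_range_succ, h, rate, if_neg hr, if_pos hl]
          ring
      · exact Or.inl fun p => by
          rw [Finset.prod_range_succ, rate, if_neg hr, if_neg hl, add_zero, mul_zero]

/-- A closed path makes as many jumps to the right as to the left. -/
lemma prod_rate_one_sub (p : ℝ) {x : ℕ → State} {n : ℕ} (h : x n = x 0) :
    ∏ k ∈ Finset.range n, rate (1 - p) (x k) (x (k + 1)) =
      ∏ k ∈ Finset.range n, rate p (x k) (x (k + 1)) := by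
  rcases prod_rate_eq_zero_or x n with h0 | ⟨a, b, hab, hw⟩
  · rw [h0, h0]
  · obtain rfl : a = b := by rw [h] at hab; omega
    rw [hw, hw, sub_sub_cancel, mul_comm]

/-! ### The embedded jump chain -/

lemma stepMeasure_singleton {p : ℝ} {x : State} (hx : totalRate p x ≠ 0) (y : State) :
    stepMeasure p x {y} = rate p x y / totalRate p x := by
  classical
  rw [stepMeasure, if_neg hx, Measure.smul_apply, Measure.sum_apply _ (measurableSet_singleton y),
    tsum_eq_single y, smul_eq_mul, div_eq_mul_inv, mul_comm]
  · simp
  · intro z hz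
    simp [hz]

lemma chainMeasure_zero (p : ℝ) (y : State) :
    chainMeasure p {x | x 0 = y} = Measure.dirac origin {y} := by
  have h : (chainMeasure p).map (Preorder.frestrictLe 0) = (Measure.dirac origin).map
      (MeasurableEquiv.piUnique fun _ : Finset.Iic 0 => State).symm := by
    rw [chainMeasure, Kernel.trajMeasure, Measure.map_comp _ _ (by fun_prop),
      Kernel.traj_map_frestrictLe, Kernel.partialTraj_self, Measure.id_comp]
  have h2 := congrArg (Measure.map fun z : Finset.Iic 0 → State => z ⟨0, by simp⟩) h
  rw [Measure.map_map (by fun_prop) (by fun_prop), Measure.map_map (by fun_prop) (by fun_prop),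
    Measure.map_dirac' (by fun_prop)] at h2
  have h3 := congrArg (fun μ : Measure State => μ {y}) h2
  rw [Measure.map_apply (by fun_prop) (measurableSet_singleton y)] at h3
  exact h3

lemma chainMeasure_succ (p : ℝ) (n : ℕ) (a : ℕ → State) :
    chainMeasure p {x | ∀ k ≤ n + 1, x k = a k} =
      chainMeasure p {x | ∀ k ≤ n, x k = a k} * stepMeasure p (a n) {a (n + 1)} := by
  set κ : (n : ℕ) → Kernel ((i : Finset.Iic n) → State) State := fun n =>
    (stepKernel p).comap (fun h : (i : Finset.Iic n) → State => h ⟨n, by simp⟩)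
      (measurable_pi_apply _)
  have h := Kernel.map_frestrictLe_trajMeasure_compProd_eq_map_trajMeasure
    (X := fun _ => State) (μ₀ := Measure.dirac origin) (κ := κ) (a := n)
  change (chainMeasure p).map _ ⊗ₘ _ = (chainMeasure p).map _ at h
  set h₀ : Finset.Iic n → State := fun i => a i
  have h3 := congrArg (fun μ => μ ({h₀} ×ˢ {a (n + 1)})) h
  rw [Measure.compProd_apply_prod (measurableSet_singleton _) (measurableSet_singleton _),
    Measure.map_apply (by fun_prop) ((measurableSet_singleton _).prod (measurableSet_singleton _)),
    lintegral_singleton,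
    Measure.map_apply (by fun_prop) (measurableSet_singleton _), mul_comm] at h3
  have e1 : {x : ℕ → State | ∀ k ≤ n, x k = a k} =
      Preorder.frestrictLe (π := fun _ => State) n ⁻¹' {h₀} := by
    ext x
    simp [funext_iff, h₀]
  have e2 : {x : ℕ → State | ∀ k ≤ n + 1, x k = a k} =
      (fun x => (Preorder.frestrictLe (π := fun _ => State) n x, x (n + 1))) ⁻¹'
        ({h₀} ×ˢ {a (n + 1)}) := by
    ext x
    simp [funext_iff, h₀, Nat.le_succ_iff, or_imp, forall_and]
  rw [e1, e2]
  exact h3.symm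

/-- If no state but possibly the last one is absorbing, the jump chain follows the path `a` with
probability the product of the rates over the product of the total rates. -/
lemma chainMeasure_path_mul (p : ℝ) {a : ℕ → State} (n : ℕ) (h0 : a 0 = origin)
    (ha : ∀ k < n, totalRate p (a k) ≠ 0) :
    chainMeasure p {x | ∀ k ≤ n, x k = a k} * ∏ k ∈ Finset.range n, totalRate p (a k) =
      ∏ k ∈ Finset.range n, rate p (a k) (a (k + 1)) := by
  induction n with
  | zero => simp [chainMeasure_zero, h0]
  | succ n ih =>
    rw [chainMeasure_succ, Finset.prod_range_succ, Finset.prod_range_succ,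
      ← ih fun k hk => ha k (hk.trans n.lt_succ_self),
      stepMeasure_singleton (ha n n.lt_succ_self)]
    rw [mul_mul_mul_comm, ENNReal.div_mul_cancel (ha n n.lt_succ_self) (totalRate_ne_top p _)]

/-! ### Exponential clocks -/

open Real in
lemma expMeasure_eq_withDensity {r : ℝ} (hr : 0 < r) :
    expMeasure r = ENNReal.ofReal r • (volume.restrict (Set.Ici 0)).withDensity
      fun x => ENNReal.ofReal (exp (-(r * x))) := by
  have h : expMeasure r = volume.withDensity (exponentialPDF r) := rfl
  have hm : Measurable fun x : ℝ => ENNReal.ofReal (exp (-(r * x))) := by fun_prop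
  rw [h, ← withDensity_indicator measurableSet_Ici, ← withDensity_smul _ (hm.indicator measurableSet_Ici)]
  congr 1
  ext x
  by_cases hx : 0 ≤ x
  · simp [exponentialPDF_of_nonneg hx, hx, ENNReal.ofReal_mul hr.le]
  · simp [exponentialPDF_of_neg (not_le.1 hx), hx]

lemma map_div_expMeasure {r : ℝ} (hr : 0 < r) :
    (expMeasure 1).map (fun x => x / r) = expMeasure r := by
  have := isProbabilityMeasure_expMeasure hr
  have : IsProbabilityMeasure ((expMeasure 1).map (fun x => x / r)) :=
    Measure.isProbabilityMeasure_map (by fun_prop)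
  refine Measure.eq_of_cdf _ _ ?_
  ext x
  rw [cdf_expMeasure_eq hr, cdf_eq_real, map_measureReal_apply (by fun_prop) measurableSet_Iic]
  have : (fun x => x / r) ⁻¹' Set.Iic x = Set.Iic (r * x) := by
    ext y
    simp [div_le_iff₀' hr]
  rw [this, ← cdf_eq_real, cdf_expMeasure_eq one_pos]
  simp [mul_nonneg_iff_of_pos_left hr]

lemma expMeasure_Ioi {s : ℝ} (hs : 0 ≤ s) :
    expMeasure 1 (Set.Ioi s) = ENNReal.ofReal (Real.exp (-s)) := by
  rw [← Set.compl_Iic, prob_compl_eq_one_sub measurableSet_Iic, ← ofReal_cdf,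
    cdf_expMeasure_eq one_pos, if_pos hs, one_mul, ← ENNReal.ofReal_one,
    ← ENNReal.ofReal_sub _ (by simpa using hs)]
  simp

lemma ae_expMeasure_pos : ∀ᵐ x ∂expMeasure 1, 0 < x := by
  have h : expMeasure 1 (Set.Ioi 0) = 1 := by simp [expMeasure_Ioi le_rfl]
  exact (prob_compl_eq_zero_iff measurableSet_Ioi).2 h

/-- A holding time of rate `q` exceeds `s` with probability `exp (-q s)`; for `q = 0` it is almost
surely infinite. -/
lemma expMeasure_div_gt (q s : ℝ) (hq : 0 ≤ q) (hs : 0 ≤ s) :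
    expMeasure 1 {x | ENNReal.ofReal s < ENNReal.ofReal x / ENNReal.ofReal q} =
      ENNReal.ofReal (Real.exp (-(q * s))) := by
  rw [← expMeasure_Ioi (mul_nonneg hq hs)]
  refine measure_congr ?_
  filter_upwards [ae_expMeasure_pos] with x hx
  refine propext ?_
  change ENNReal.ofReal s < ENNReal.ofReal x / ENNReal.ofReal q ↔ q * s < x
  rcases hq.eq_or_lt with rfl | hq
  · simp [ENNReal.div_zero, hx]
  · rw [← ENNReal.ofReal_div_of_pos hq, ENNReal.ofReal_lt_ofReal_iff (by positivity),
      lt_div_iff₀' hq]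

lemma lintegral_pi_prod {n : ℕ} (ν : Fin n → Measure ℝ) [∀ k, SigmaFinite (ν k)]
    (f : Fin n → ℝ → ℝ≥0∞) (hf : ∀ k, Measurable (f k)) :
    ∫⁻ x, ∏ k, f k (x k) ∂Measure.pi ν = ∏ k, ∫⁻ x, f k x ∂ν k := by
  induction n with
  | zero => simp
  | succ n ih =>
    rw [← (measurePreserving_piFinSuccAbove ν 0).symm.lintegral_comp
      (by fun_prop), Fin.prod_univ_succ, ← ih _ _ fun k => hf _]
    simp only [Fin.prod_univ_succ, MeasurableEquiv.piFinSuccAbove_symm_apply,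
      Fin.insertNthEquiv_zero, Fin.consEquiv_apply, Fin.cons_zero, Fin.cons_succ,
      Fin.zero_succAbove]
    exact lintegral_prod_mul (hf 0).aemeasurable
      (Finset.measurable_prod _ fun k _ => (hf _).comp (measurable_pi_apply k)).aemeasurable

/-- The joint law of independent holding times of rates `r k` has density
`∏ r k * exp (-∑ r k * τ k)` on the positive orthant. -/
lemma map_div_pi_expMeasure {n : ℕ} (r : Fin n → ℝ) (hr : ∀ k, 0 < r k) :
    (Measure.pi fun _ : Fin n => expMeasure 1).map (fun x k => x k / r k) =
      (∏ k, ENNReal.ofReal (r k)) •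
        (Measure.pi fun _ : Fin n => (volume.restrict (Set.Ici 0) : Measure ℝ)).withDensity
          fun x => ∏ k, ENNReal.ofReal (Real.exp (-(r k * x k))) := by
  have : ∀ k, SigmaFinite ((expMeasure 1).map fun x => x / r k) := fun k =>
    have := Measure.isProbabilityMeasure_map (μ := expMeasure 1) (f := fun x => x / r k)
      (by fun_prop)
    inferInstance
  rw [Measure.pi_map_pi (f := fun k x => x / r k) (fun k => by fun_prop)]
  refine Measure.pi_eq fun s hs => ?_
  rw [Measure.smul_apply, withDensity_apply _ (MeasurableSet.univ_pi hs), Measure.restrict_pi_pi,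
    lintegral_pi_prod _ (fun k x => ENNReal.ofReal (Real.exp (-(r k * x)))) fun k => by fun_prop,
    smul_eq_mul, ← Finset.prod_mul_distrib]
  refine Finset.prod_congr rfl fun k _ => ?_
  rw [map_div_expMeasure (hr k), expMeasure_eq_withDensity (hr k), Measure.smul_apply,
    withDensity_apply _ (hs k), smul_eq_mul]

/-- The first `n + 1` clocks, with the last one singled out. -/
lemma map_clocks (n : ℕ) :
    (Measure.infinitePi fun _ : ℕ => expMeasure 1).map
        (fun e => (e n, fun k : Fin n => e k)) =
      (expMeasure 1).prod (Measure.pi fun _ : Fin n => expMeasure 1) := by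
  have h1 : (Measure.infinitePi fun _ : ℕ => expMeasure 1).map (fun e (k : Fin (n + 1)) => e k) =
      Measure.pi fun _ : Fin (n + 1) => expMeasure 1 := by
    refine (Measure.pi_eq fun s hs => ?_).symm
    set s' : ℕ → Set ℝ := fun k => if h : k < n + 1 then s ⟨k, h⟩ else Set.univ
    have hs' : ∀ k, MeasurableSet (s' k) := fun k => by
      by_cases h : k < n + 1
      · simpa only [s', dif_pos h] using hs _
      · simp only [s', dif_neg h, MeasurableSet.univ]
    have hpre : (fun e : ℕ → ℝ => fun k : Fin (n + 1) => e k) ⁻¹' Set.univ.pi s =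
        Set.pi (Finset.range (n + 1)) s' := by
      ext e
      simp only [Set.mem_preimage, Set.mem_pi, Set.mem_univ, true_imp_iff, Finset.coe_range,
        Set.mem_Iio, Fin.forall_iff, s']
      exact forall₂_congr fun k hk => by rw [dif_pos hk]
    rw [Measure.map_apply (by fun_prop) (MeasurableSet.univ_pi hs), hpre,
      Measure.infinitePi_pi _ fun k _ => hs' k, Finset.prod_range]
    refine Finset.prod_congr rfl fun k _ => ?_
    simp only [s', dif_pos k.2]
  have h2 := (measurePreserving_piFinSuccAbove (fun _ : Fin (n + 1) => expMeasure 1)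
    (Fin.last n)).map_eq
  rw [← h1, Measure.map_map (MeasurableEquiv.measurable _) (by fun_prop)] at h2
  rw [← h2]
  congr 1
  ext e k
  · simp [MeasurableEquiv.piFinSuccAbove, Fin.insertNthEquiv]
  · simp [MeasurableEquiv.piFinSuccAbove, Fin.insertNthEquiv, Fin.init]

/-- Given a measurable set `B` of holding times `τ k`, `k < n`, of total length at most `t`, the
event that the holding times, of rates `r k`, lie in `B` and that the next one, of rate `q`, exceeds
the remaining time has probability `∏ r k` times the integral of
`exp (-∑ r k * τ k - q * (t - ∑ τ k))` over `B`. -/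
lemma infinitePi_clocks (n : ℕ) (r : Fin n → ℝ) (hr : ∀ k, 0 < r k) (q : ℝ) (hq : 0 ≤ q) (t : ℝ)
    {B : Set (Fin n → ℝ)} (hB : MeasurableSet B) (hBt : ∀ τ ∈ B, ∑ k, τ k ≤ t) :
    Measure.infinitePi (fun _ : ℕ => expMeasure 1)
        {e | (fun k : Fin n => e k / r k) ∈ B ∧ ENNReal.ofReal (t - ∑ k : Fin n, e k / r k) <
          ENNReal.ofReal (e n) / ENNReal.ofReal q} =
      (∏ k, ENNReal.ofReal (r k)) *
        ∫⁻ τ in B, ENNReal.ofReal (Real.exp (-(∑ k, r k * τ k) - q * (t - ∑ k, τ k)))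
          ∂Measure.pi fun _ : Fin n => (volume.restrict (Set.Ici 0) : Measure ℝ) := by
  set S : Set (ℝ × (Fin n → ℝ)) := {z | (fun k => z.2 k / r k) ∈ B ∧
    ENNReal.ofReal (t - ∑ k, z.2 k / r k) < ENNReal.ofReal z.1 / ENNReal.ofReal q}
  have hS : MeasurableSet S :=
    ((show Measurable fun (z : ℝ × (Fin n → ℝ)) k => z.2 k / r k by fun_prop) hB).inter
      (measurableSet_lt
      (show Measurable fun z : ℝ × (Fin n → ℝ) => ENNReal.ofReal (t - ∑ k, z.2 k / r k) by fun_prop)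
      (show Measurable fun z : ℝ × (Fin n → ℝ) => ENNReal.ofReal z.1 / ENNReal.ofReal q by fun_prop))
  set G : (Fin n → ℝ) → ℝ≥0∞ := B.indicator fun τ =>
    ENNReal.ofReal (Real.exp (-(q * (t - ∑ k, τ k))))
  have hG : Measurable G := Measurable.indicator (by fun_prop) hB
  have hslice : ∀ y : Fin n → ℝ, expMeasure 1 ((fun x => (x, y)) ⁻¹' S) =
      G fun k => y k / r k := fun y => by
    by_cases hy : (fun k => y k / r k) ∈ B
    · have hset : (fun x => (x, y)) ⁻¹' S = {x | ENNReal.ofReal (t - ∑ k, y k / r k) <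
          ENNReal.ofReal x / ENNReal.ofReal q} := by
        ext x
        simp [S, hy]
      rw [hset, expMeasure_div_gt q _ hq (sub_nonneg.2 (hBt _ hy))]
      simp [G, hy]
    · have hset : (fun x => (x, y)) ⁻¹' S = ∅ := by
        ext x
        simp [S, hy]
      simp [hset, G, hy]
  have hpre : {e : ℕ → ℝ | (fun k : Fin n => e k / r k) ∈ B ∧
      ENNReal.ofReal (t - ∑ k : Fin n, e k / r k) <
        ENNReal.ofReal (e n) / ENNReal.ofReal q} =
      (fun e : ℕ → ℝ => (e n, fun k : Fin n => e k)) ⁻¹' S := rfl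
  rw [hpre, ← Measure.map_apply (by fun_prop) hS, map_clocks, Measure.prod_apply_symm hS]
  simp only [hslice]
  rw [← lintegral_map (μ := Measure.pi fun _ : Fin n => expMeasure 1)
      (g := fun x k => x k / r k) hG (by fun_prop), map_div_pi_expMeasure r hr,
    lintegral_smul_measure, lintegral_withDensity_eq_lintegral_mul _ (by fun_prop) hG,
    ← lintegral_indicator hB, smul_eq_mul]
  congr 2
  ext τ
  by_cases hτ : τ ∈ B
  · simp only [Pi.mul_apply, G, Set.indicator_of_mem hτ]
    rw [← ENNReal.ofReal_prod_of_nonneg fun _ _ => (Real.exp_pos _).le, ← Real.exp_sum,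
      ← ENNReal.ofReal_mul (Real.exp_pos _).le, ← Real.exp_add, Finset.sum_neg_distrib,
      ← sub_eq_add_neg]
  · simp [G, hτ]

/-! ### The trajectory as a function of states and holding times -/

open Classical in
/-- The state at time `s` of the jump process that stays in the states `x 0, x 1, …` for the times
`T 0, T 1, …`; it is `none` from the time on at which the jumps accumulate. The process `X p` is,
by definition, this trajectory with `T k` the `k`-th clock divided by the total rate of `x k`. -/
noncomputable def trajectory (x : ℕ → State) (T : ℕ → ℝ≥0∞) (s : ℝ≥0) : Option State :=
  if h : ∃ n, (s : ℝ≥0∞) < ∑ k ∈ Finset.range (n + 1), T k then some (x (Nat.find h)) else none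

open Classical in
/-- Up to the time of jump `n + 1`, the trajectory depends on the states up to the `n`-th and on the
holding times before it only. -/
lemma trajectory_congr {x x' : ℕ → State} {T T' : ℕ → ℝ≥0∞} {s : ℝ≥0} {n : ℕ}
    (hx : ∀ k ≤ n, x k = x' k) (hT : ∀ k < n, T k = T' k)
    (h : (s : ℝ≥0∞) < ∑ k ∈ Finset.range (n + 1), T k)
    (h' : (s : ℝ≥0∞) < ∑ k ∈ Finset.range (n + 1), T' k) :
    trajectory x T s = trajectory x' T' s := by
  have hsum : ∀ m < n, ∑ k ∈ Finset.range (m + 1), T k = ∑ k ∈ Finset.range (m + 1), T' k :=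
    fun m hm => Finset.sum_congr rfl fun k hk => hT k (by have := Finset.mem_range.1 hk; omega)
  have hE : ∃ n, (s : ℝ≥0∞) < ∑ k ∈ Finset.range (n + 1), T k := ⟨n, h⟩
  have hE' : ∃ n, (s : ℝ≥0∞) < ∑ k ∈ Finset.range (n + 1), T' k := ⟨n, h'⟩
  have hle : Nat.find hE ≤ n := Nat.find_min' hE h
  have hfind : Nat.find hE' = Nat.find hE := by
    rw [Nat.find_eq_iff]
    refine ⟨?_, fun m hm => ?_⟩
    · rcases hle.eq_or_lt with e | e
      · rwa [e]
      · rw [← hsum _ e]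
        exact Nat.find_spec hE
    · rw [← hsum _ (hm.trans_le hle)]
      exact Nat.find_min hE hm
  rw [trajectory, trajectory, dif_pos hE, dif_pos hE', hfind, hx _ hle]

open Classical in
lemma measurable_trajectory (x : ℕ → State) (s : ℝ≥0) : Measurable fun T => trajectory x T s := by
  have hm : ∀ n, MeasurableSet {T : ℕ → ℝ≥0∞ | (s : ℝ≥0∞) < ∑ k ∈ Finset.range (n + 1), T k} :=
    fun n => measurableSet_lt measurable_const (by fun_prop)
  have hE : MeasurableSet
      {T : ℕ → ℝ≥0∞ | ∃ n, (s : ℝ≥0∞) < ∑ k ∈ Finset.range (n + 1), T k} := by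
    simp only [Set.ofPred_exists]; exact MeasurableSet.iUnion hm
  refine Measurable.dite (f := fun T : {T : ℕ → ℝ≥0∞ |
      ∃ n, (s : ℝ≥0∞) < ∑ k ∈ Finset.range (n + 1), T k} => some (x (Nat.find T.2)))
    (g := fun _ => none) ?_ measurable_const hE
  exact Measurable.find
    (f := fun n (_ : {T : ℕ → ℝ≥0∞ | ∃ n, (s : ℝ≥0∞) < ∑ k ∈ Finset.range (n + 1), T k}) =>
      some (x n))
    (p := fun n T => (s : ℝ≥0∞) < ∑ k ∈ Finset.range (n + 1), (T : ℕ → ℝ≥0∞) k)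
    (fun n => measurable_const) (fun n => measurable_subtype_coe (hm n)) (fun T => T.2)

/-- Finitely many holding times, followed by infinite ones. -/
noncomputable def extendTimes {n : ℕ} (τ : Fin n → ℝ) (k : ℕ) : ℝ≥0∞ :=
  if h : k < n then ENNReal.ofReal (τ ⟨k, h⟩) else ∞

lemma measurable_extendTimes (n : ℕ) : Measurable (extendTimes (n := n)) := by
  refine measurable_pi_lambda _ fun k => ?_
  unfold extendTimes
  split_ifs with h
  · fun_prop
  · exact measurable_const

/-- The holding times `τ` in the first `n` states of `a` such that the `n`-th jump takes place
before `t`, and that the resulting trajectory on `[0, t]`, if no further jump occurs, is in `A`. -/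
def admissibleTimes (a : ℕ → State) (n : ℕ) (t : ℝ≥0)
    (A : Set (Set.Icc (0 : ℝ≥0) t → Option State)) : Set (Fin n → ℝ) :=
  {τ | (∀ k, 0 ≤ τ k) ∧ ∑ k, τ k ≤ t ∧
    (fun s : Set.Icc (0 : ℝ≥0) t => trajectory a (extendTimes τ) s) ∈ A}

lemma measurableSet_admissibleTimes (a : ℕ → State) (n : ℕ) (t : ℝ≥0)
    {A : Set (Set.Icc (0 : ℝ≥0) t → Option State)} (hA : MeasurableSet A) :
    MeasurableSet (admissibleTimes a n t A) := by
  have h1 : MeasurableSet {τ : Fin n → ℝ | ∀ k, 0 ≤ τ k} := by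
    simp only [Set.ofPred_forall]
    exact MeasurableSet.iInter fun k => measurableSet_le measurable_const (measurable_pi_apply k)
  have h2 : MeasurableSet {τ : Fin n → ℝ | ∑ k, τ k ≤ t} :=
    measurableSet_le (by fun_prop) measurable_const
  have h3 : Measurable fun (τ : Fin n → ℝ) (s : Set.Icc (0 : ℝ≥0) t) =>
      trajectory a (extendTimes τ) s :=
    measurable_pi_lambda _ fun s => (measurable_trajectory a s).comp (measurable_extendTimes n)
  exact h1.inter (h2.inter (h3 hA))

/-- The part of the density of a path that does not depend on the parameter `p`, integrated over
the admissible holding times. -/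
noncomputable def pathIntegral (a : ℕ → State) (n : ℕ) (t : ℝ≥0)
    (A : Set (Set.Icc (0 : ℝ≥0) t → Option State)) : ℝ≥0∞ :=
  ∫⁻ τ in admissibleTimes a n t A, ENNReal.ofReal (Real.exp
      (-(∑ k : Fin n, leftMoves (a k) * τ k) - leftMoves (a n) * (t - ∑ k, τ k)))
    ∂Measure.pi fun _ : Fin n => (volume.restrict (Set.Ici 0) : Measure ℝ)

/-! ### The law of the process along a given path -/

/-- The event that the clocks `e` and the path `a` produce exactly `n` jumps up to time `t`, along
a trajectory in `A`. -/
def clockEvent (p : ℝ) (a : ℕ → State) (n : ℕ) (t : ℝ≥0)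
    (A : Set (Set.Icc (0 : ℝ≥0) t → Option State)) : Set (ℕ → ℝ) :=
  {e | jumpTime p n (a, e) ≤ t ∧ (t : ℝ≥0∞) < jumpTime p (n + 1) (a, e) ∧ path p t (a, e) ∈ A}

lemma ae_clocks_pos : ∀ᵐ e ∂Measure.infinitePi fun _ : ℕ => expMeasure 1, ∀ k, 0 < e k :=
  ae_all_iff.2 fun k =>
    (measurePreserving_eval_infinitePi (fun _ : ℕ => expMeasure 1) k).quasiMeasurePreserving.ae
      ae_expMeasure_pos

/-- The total rates are `leftMoves (a k) + p`. As the holding times add up to `t`, the parameter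
contributes the constant factor `exp (-p t)` to their density. -/
lemma infinitePi_clockEvent {p : ℝ} (hp0 : 0 ≤ p) (hp1 : p ≤ 1) (a : ℕ → State) (n : ℕ) (t : ℝ≥0)
    {A : Set (Set.Icc (0 : ℝ≥0) t → Option State)} (hA : MeasurableSet A)
    (ha : ∀ k < n, totalRate p (a k) ≠ 0) :
    Measure.infinitePi (fun _ : ℕ => expMeasure 1) (clockEvent p a n t A) =
      ENNReal.ofReal (Real.exp (-(p * t))) * (∏ k ∈ Finset.range n, totalRate p (a k)) *
        pathIntegral a n t A := by
  set r : Fin n → ℝ := fun k => leftMoves (a k) + p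
  set q : ℝ := leftMoves (a n) + p
  have hr : ∀ k, 0 < r k := fun k => by
    have := ha k k.2
    rw [totalRate_eq hp0 hp1] at this
    simpa using this
  have hq : 0 ≤ q := by positivity
  have hae : clockEvent p a n t A =ᵐ[Measure.infinitePi fun _ : ℕ => expMeasure 1]
      {e | (fun k : Fin n => e k / r k) ∈ admissibleTimes a n t A ∧
        ENNReal.ofReal (t - ∑ k : Fin n, e k / r k) <
          ENNReal.ofReal (e n) / ENNReal.ofReal q} := by
    filter_upwards [ae_clocks_pos] with e he
    refine propext ?_
    change (jumpTime p n (a, e) ≤ t ∧ (t : ℝ≥0∞) < jumpTime p (n + 1) (a, e) ∧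
      path p t (a, e) ∈ A) ↔ ((_ ∧ _ ∧ _) ∧ _)
    set τ : Fin n → ℝ := fun k => e k / r k
    have hτ : ∀ k, 0 ≤ τ k := fun k => (div_pos (he k) (hr k)).le
    have hT : ∀ k (hk : k < n), ENNReal.ofReal (e k) / totalRate p (a k) =
        ENNReal.ofReal (τ ⟨k, hk⟩) := fun k hk => by
      rw [totalRate_eq hp0 hp1, ← ENNReal.ofReal_div_of_pos (hr ⟨k, hk⟩)]
    have hn : jumpTime p n (a, e) = ENNReal.ofReal (∑ k, τ k) := by
      rw [ENNReal.ofReal_sum_of_nonneg fun k _ => hτ k, jumpTime, Finset.sum_range]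
      exact Finset.sum_congr rfl fun k _ => hT k k.2
    have hn1 : jumpTime p (n + 1) (a, e) =
        ENNReal.ofReal (∑ k, τ k) + ENNReal.ofReal (e n) / ENNReal.ofReal q := by
      rw [← hn, jumpTime, Finset.sum_range_succ, ← totalRate_eq hp0 hp1]
      rfl
    have htn : jumpTime p n (a, e) ≤ t ↔ ∑ k, τ k ≤ t := by
      rw [hn, ENNReal.ofReal_le_iff_le_toReal ENNReal.coe_ne_top]
      rfl
    have htn1 : ∑ k, τ k ≤ t → ((t : ℝ≥0∞) < jumpTime p (n + 1) (a, e) ↔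
        ENNReal.ofReal (t - ∑ k, τ k) < ENNReal.ofReal (e n) / ENNReal.ofReal q) := fun h => by
      have e1 : (t : ℝ≥0∞) = ENNReal.ofReal (∑ k, τ k) + ENNReal.ofReal (t - ∑ k, τ k) := by
        rw [← ENNReal.ofReal_add (Finset.sum_nonneg fun k _ => hτ k) (sub_nonneg.2 h),
          add_sub_cancel, ENNReal.ofReal_coe_nnreal]
      rw [hn1, e1, ENNReal.add_lt_add_iff_left ENNReal.ofReal_ne_top]
    -- Up to time `t` the current holding time may as well be infinite.
    have hpath : (t : ℝ≥0∞) < jumpTime p (n + 1) (a, e) → path p t (a, e) =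
        fun s : Set.Icc (0 : ℝ≥0) t => trajectory a (extendTimes τ) s := fun h => by
      funext s
      have hs : ((s : ℝ≥0) : ℝ≥0∞) ≤ t := ENNReal.coe_le_coe.2 s.2.2
      refine trajectory_congr (n := n) (fun _ _ => rfl) (fun k hk => ?_) (hs.trans_lt h) ?_
      · rw [extendTimes, dif_pos hk]
        exact hT k hk
      · rw [Finset.sum_range_succ, extendTimes, dif_neg (lt_irrefl n), add_top]
        exact ENNReal.coe_lt_top
    constructor
    · rintro ⟨h1, h2, h3⟩
      have h1' := htn.1 h1
      exact ⟨⟨hτ, h1', hpath h2 ▸ h3⟩, (htn1 h1').1 h2⟩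
    · rintro ⟨⟨-, h1, h2⟩, h3⟩
      have h3' := (htn1 h1).2 h3
      exact ⟨htn.2 h1, h3', (hpath h3').symm ▸ h2⟩
  rw [measure_congr hae, infinitePi_clocks n r hr q hq t (measurableSet_admissibleTimes a n t hA)
    fun τ h => h.2.1, pathIntegral, Finset.prod_range, mul_assoc, mul_left_comm]
  simp only [totalRate_eq hp0 hp1]
  congr 1
  rw [← lintegral_const_mul _ (by fun_prop)]
  refine lintegral_congr fun τ => ?_
  rw [← ENNReal.ofReal_mul (Real.exp_pos _).le, ← Real.exp_add]
  congr 2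
  simp only [r, q, add_mul, Finset.sum_add_distrib, ← Finset.mul_sum]
  ring

/-- The event that the process follows the states `a 0, …, a n` up to time `t`, along a trajectory
in `A`. -/
def pathEvent (p : ℝ) (a : ℕ → State) (n : ℕ) (t : ℝ≥0)
    (A : Set (Set.Icc (0 : ℝ≥0) t → Option State)) : Set Sample :=
  {ω | (∀ k ≤ n, ω.1 k = a k) ∧ jumpTime p n ω ≤ t ∧ (t : ℝ≥0∞) < jumpTime p (n + 1) ω ∧
    path p t ω ∈ A}

lemma pathEvent_eq_prod (p : ℝ) (a : ℕ → State) (n : ℕ) (t : ℝ≥0)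
    (A : Set (Set.Icc (0 : ℝ≥0) t → Option State)) :
    pathEvent p a n t A = {x | ∀ k ≤ n, x k = a k} ×ˢ clockEvent p a n t A := by
  ext ⟨x, e⟩
  simp only [pathEvent, clockEvent, Set.mem_ofPred_eq, Set.mem_prod]
  refine and_congr_right fun hx => ?_
  have hj : ∀ m ≤ n + 1, jumpTime p m (x, e) = jumpTime p m (a, e) := fun m hm =>
    Finset.sum_congr rfl fun k hk => by
      have := Finset.mem_range.1 hk
      simp only [hx k (by omega)]
  rw [hj n n.le_succ, hj (n + 1) le_rfl]
  refine and_congr_right fun _ => and_congr_right fun h => ?_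
  suffices path p t (x, e) = path p t (a, e) by rw [this]
  funext s
  have hs : ((s : ℝ≥0) : ℝ≥0∞) ≤ t := ENNReal.coe_le_coe.2 s.2.2
  refine trajectory_congr (n := n) hx (fun k hk => by simp only [hx k hk.le]) ?_ (hs.trans_lt h)
  exact (hs.trans_lt h).trans_eq (hj (n + 1) le_rfl).symm

lemma P_pathEvent {p : ℝ} (hp0 : 0 ≤ p) (hp1 : p ≤ 1) {a : ℕ → State} (h0 : a 0 = origin) (n : ℕ)
    (t : ℝ≥0) {A : Set (Set.Icc (0 : ℝ≥0) t → Option State)} (hA : MeasurableSet A) :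
    P p (pathEvent p a n t A) = ENNReal.ofReal (Real.exp (-(p * t))) *
      (∏ k ∈ Finset.range n, rate p (a k) (a (k + 1))) * pathIntegral a n t A := by
  rw [pathEvent_eq_prod, P, Measure.prod_prod]
  by_cases ha : ∀ k < n, totalRate p (a k) ≠ 0
  · rw [infinitePi_clockEvent hp0 hp1 a n t hA ha, ← chainMeasure_path_mul p n h0 ha]
    ring
  · -- An absorbing state is never left: its holding time is infinite.
    push Not at ha
    obtain ⟨k, hk, hk0⟩ := ha
    have hrate : rate p (a k) (a (k + 1)) = 0 :=
      le_antisymm ((ENNReal.le_tsum (a (k + 1))).trans_eq hk0) zero_le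
    have hnull : Measure.infinitePi (fun _ : ℕ => expMeasure 1) (clockEvent p a n t A) = 0 := by
      refine measure_mono_null (fun e he => ?_) (ae_iff.1 ae_clocks_pos)
      refine fun hpos : ∀ k, 0 < e k => ?_
      refine (he.1.trans_lt ENNReal.coe_lt_top).not_ge ?_
      calc ∞ = ENNReal.ofReal (e k) / totalRate p (a k) := by
            rw [hk0, ENNReal.div_zero (by simpa using hpos k)]
        _ ≤ jumpTime p n (a, e) := Finset.single_le_sum
            (f := fun k => ENNReal.ofReal (e k) / totalRate p (a k)) (fun _ _ => zero_le)
            (Finset.mem_range.2 hk)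
    rw [hnull, Finset.prod_eq_zero (Finset.mem_range.2 hk) hrate]
    simp

lemma P_pathEvent_eq_zero (p : ℝ) {a : ℕ → State} (h0 : a 0 ≠ origin) (n : ℕ) (t : ℝ≥0)
    (A : Set (Set.Icc (0 : ℝ≥0) t → Option State)) : P p (pathEvent p a n t A) = 0 := by
  have h : chainMeasure p {x | ∀ k ≤ n, x k = a k} = 0 := by
    refine measure_mono_null (fun x hx => hx 0 (Nat.zero_le n)) ((chainMeasure_zero p (a 0)).trans ?_)
    simp [h0.symm]
  rw [pathEvent_eq_prod, P, Measure.prod_prod, h, zero_mul]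

/-- For a path from `O` to `O`, replacing `p` by `1 - p` only changes the total rates, all of them
by the same amount. -/
lemma P_pathEvent_one_sub {p : ℝ} (hp0 : 0 ≤ p) (hp1 : p ≤ 1) {a : ℕ → State} {n : ℕ}
    (hn : a n = origin) (t : ℝ≥0) {A : Set (Set.Icc (0 : ℝ≥0) t → Option State)}
    (hA : MeasurableSet A) :
    P p (pathEvent p a n t A) = ENNReal.ofReal (Real.exp (-(2 * p - 1) * t)) *
      P (1 - p) (pathEvent (1 - p) a n t A) := by
  by_cases h0 : a 0 = origin
  · rw [P_pathEvent hp0 hp1 h0 n t hA, P_pathEvent (sub_nonneg.2 hp1) (by linarith) h0 n t hA,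
      prod_rate_one_sub p (hn.trans h0.symm), ← mul_assoc, ← mul_assoc,
      ← ENNReal.ofReal_mul (Real.exp_pos _).le, ← Real.exp_add]
    congr 4
    ring
  · rw [P_pathEvent_eq_zero p h0, P_pathEvent_eq_zero (1 - p) h0, mul_zero]

/-! ### Summation over the paths -/

lemma jumpTime_mono (p : ℝ) (ω : Sample) : Monotone fun n => jumpTime p n ω := fun _ _ h =>
  Finset.sum_le_sum_of_subset (Finset.range_subset_range.2 h)

open Classical in
lemma mem_returnEvent_iff {p : ℝ} {t : ℝ≥0} {ω : Sample} :
    ω ∈ returnEvent p t ↔ ∃ n, jumpTime p n ω ≤ t ∧ (t : ℝ≥0∞) < jumpTime p (n + 1) ω ∧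
      ω.1 n = origin := by
  change X p t ω = some origin ↔ _
  constructor
  · intro h
    by_cases hE : ∃ n, (t : ℝ≥0∞) < jumpTime p (n + 1) ω
    · rw [X, dif_pos hE, Option.some_inj] at h
      refine ⟨Nat.find hE, ?_, Nat.find_spec hE, h⟩
      rcases hm : Nat.find hE with _ | m
      · simp [jumpTime]
      · exact not_lt.1 (Nat.find_min hE (by omega : m < Nat.find hE))
    · rw [X, dif_neg hE] at h
      cases h
  · rintro ⟨n, h1, h2, h3⟩
    have hE : ∃ n, (t : ℝ≥0∞) < jumpTime p (n + 1) ω := ⟨n, h2⟩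
    have hfind : Nat.find hE = n :=
      (Nat.find_eq_iff hE).2 ⟨h2, fun m hm => not_lt.2 ((jumpTime_mono p ω hm).trans h1)⟩
    rw [X, dif_pos hE, hfind, h3]

/-- The finite path `a`, continued by its last state. -/
def extendPath {n : ℕ} (a : Fin (n + 1) → State) (k : ℕ) : State := a (Fin.ofNat (n + 1) (min k n))

lemma extendPath_apply {n : ℕ} (a : Fin (n + 1) → State) {k : ℕ} (hk : k ≤ n) :
    extendPath a k = a ⟨k, Nat.lt_succ_of_le hk⟩ := by
  unfold extendPath
  congr 1
  ext
  simp [min_eq_left hk, Nat.mod_eq_of_lt (Nat.lt_succ_of_le hk)]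

lemma measurableSet_returnEvent (p : ℝ) (t : ℝ≥0) : MeasurableSet (returnEvent p t) :=
  measurable_X p t (measurableSet_singleton _)

/-- The possible sequences of states that lead to `O`, along with their number of jumps. -/
abbrev ReturnPath : Type := {a : Σ n : ℕ, Fin (n + 1) → State // a.2 (Fin.last a.1) = origin}

lemma returnEvent_inter_eq_iUnion (p : ℝ) (t : ℝ≥0)
    (A : Set (Set.Icc (0 : ℝ≥0) t → Option State)) :
    returnEvent p t ∩ path p t ⁻¹' A =
      ⋃ i : ReturnPath, pathEvent p (extendPath i.1.2) i.1.1 t A := by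
  ext ω
  simp only [Set.mem_inter_iff, mem_returnEvent_iff, Set.mem_preimage, Set.mem_iUnion, pathEvent,
    Set.mem_ofPred_eq]
  constructor
  · rintro ⟨⟨n, h1, h2, h3⟩, h4⟩
    exact ⟨⟨⟨n, fun k => ω.1 k⟩, h3⟩, fun k hk =>
      (extendPath_apply (fun k : Fin (n + 1) => ω.1 k) hk).symm, h1, h2, h4⟩
  · rintro ⟨⟨⟨n, a⟩, ha⟩, h1, h2, h3, h4⟩
    exact ⟨⟨n, h2, h3, ((h1 n le_rfl).trans (extendPath_apply a le_rfl)).trans ha⟩, h4⟩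

lemma pairwise_disjoint_pathEvent (p : ℝ) (t : ℝ≥0)
    (A : Set (Set.Icc (0 : ℝ≥0) t → Option State)) :
    Pairwise fun i j : ReturnPath => Disjoint (pathEvent p (extendPath i.1.2) i.1.1 t A)
      (pathEvent p (extendPath j.1.2) j.1.1 t A) := by
  rintro ⟨⟨n, a⟩, ha⟩ ⟨⟨m, b⟩, hb⟩ hne
  refine Set.disjoint_left.2 ?_
  rintro ω ⟨h1, h2, h3, -⟩ ⟨h1', h2', h3', -⟩
  apply hne
  simp only at h1 h2 h3 h1' h2' h3'
  have hnm : n = m := by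
    by_contra h
    rcases Nat.lt_or_gt_of_ne h with h | h
    · exact (h3.trans_le (jumpTime_mono p ω h)).not_ge h2'
    · exact (h3'.trans_le (jumpTime_mono p ω h)).not_ge h2
  subst hnm
  have hab : a = b := funext fun k => by
    have hk : (k : ℕ) ≤ n := Nat.le_of_lt_succ k.2
    rw [← extendPath_apply a hk, ← extendPath_apply b hk, ← h1 k hk, ← h1' k hk]
  subst hab
  rfl

lemma measurableSet_pathEvent (p : ℝ) (a : ℕ → State) (n : ℕ) (t : ℝ≥0)
    {A : Set (Set.Icc (0 : ℝ≥0) t → Option State)} (hA : MeasurableSet A) :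
    MeasurableSet (pathEvent p a n t A) := by
  have h1 : MeasurableSet {ω : Sample | ∀ k ≤ n, ω.1 k = a k} := by
    simp only [Set.ofPred_forall]
    exact MeasurableSet.iInter fun k => MeasurableSet.iInter fun _ =>
      (show Measurable fun ω : Sample => ω.1 k by fun_prop) (measurableSet_singleton (a k))
  exact h1.inter ((measurableSet_le (measurable_jumpTime p n) measurable_const).inter
    ((measurableSet_lt measurable_const (measurable_jumpTime p (n + 1))).inter
      (measurable_path p t hA)))

/-- Both parts of the theorem come from this identity: on the event of a return to `O` at time `t`
the path measures with parameters `p` and `1 - p` are proportional. -/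
lemma P_returnEvent_inter {p : ℝ} (hp0 : 0 ≤ p) (hp1 : p ≤ 1) (t : ℝ≥0)
    {A : Set (Set.Icc (0 : ℝ≥0) t → Option State)} (hA : MeasurableSet A) :
    P p (returnEvent p t ∩ path p t ⁻¹' A) = ENNReal.ofReal (Real.exp (-(2 * p - 1) * t)) *
      P (1 - p) (returnEvent (1 - p) t ∩ path (1 - p) t ⁻¹' A) := by
  have hsum : ∀ p : ℝ, P p (returnEvent p t ∩ path p t ⁻¹' A) =
      ∑' i : ReturnPath, P p (pathEvent p (extendPath i.1.2) i.1.1 t A) := fun p => by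
    rw [returnEvent_inter_eq_iUnion, measure_iUnion (pairwise_disjoint_pathEvent p t A)
      fun i => measurableSet_pathEvent p _ _ t hA]
  rw [hsum, hsum, ← ENNReal.tsum_mul_left]
  refine tsum_congr fun i => P_pathEvent_one_sub hp0 hp1 ?_ t hA
  exact (extendPath_apply i.1.2 le_rfl).trans i.2

/-- With positive probability the process has not left `O` at time `t`. -/
lemma P_returnEvent_ne_zero {p : ℝ} (hp0 : 0 ≤ p) (hp1 : p ≤ 1) (t : ℝ≥0) :
    P p (returnEvent p t) ≠ 0 := by
  set q : ℝ := leftMoves origin + p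
  set S : Set ℝ := {x | ENNReal.ofReal t < ENNReal.ofReal x / ENNReal.ofReal q}
  have hS : MeasurableSet S := measurableSet_lt measurable_const (by fun_prop)
  have hsub : {x : ℕ → State | x 0 = origin} ×ˢ ((fun e : ℕ → ℝ => e 0) ⁻¹' S) ⊆
      returnEvent p t := by
    rintro ⟨x, e⟩ ⟨hx, he⟩
    refine mem_returnEvent_iff.2 ⟨0, by simp [jumpTime], ?_, hx⟩
    have hx : x 0 = origin := hx
    have he : ENNReal.ofReal t < ENNReal.ofReal (e 0) / ENNReal.ofReal q := he
    simpa [jumpTime, hx, totalRate_eq hp0 hp1] using he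
  refine fun h => ?_
  have h2 := measure_mono_null hsub h
  rw [P, Measure.prod_prod, chainMeasure_zero,
    (measurePreserving_eval_infinitePi (fun _ : ℕ => expMeasure 1) 0).measure_preimage
      hS.nullMeasurableSet, expMeasure_div_gt q t (by positivity) t.2] at h2
  simp only [Measure.dirac_apply, Set.mem_singleton_iff, Set.indicator_of_mem, Pi.one_apply, one_mul,
    ENNReal.ofReal_eq_zero] at h2
  exact (Real.exp_pos _).not_ge h2

end Exclusion

open Exclusion in
theorem theorem4p1 (p : ℝ) (hp0 : 0 ≤ p) (hp1 : p ≤ 1) (t : ℝ≥0) :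
    (Exclusion.P p).real (Exclusion.returnEvent p t) =
        Real.exp (-(2 * p - 1) * t) *
          (Exclusion.P (1 - p)).real (Exclusion.returnEvent (1 - p) t) ∧
      (Exclusion.P p) (Exclusion.returnEvent p t) ≠ 0 ∧
      Exclusion.bridgeLaw p t = Exclusion.bridgeLaw (1 - p) t := by
  have hret : P p (returnEvent p t) = ENNReal.ofReal (Real.exp (-(2 * p - 1) * t)) *
      P (1 - p) (returnEvent (1 - p) t) := by
    simpa using P_returnEvent_inter hp0 hp1 t MeasurableSet.univ
  refine ⟨?_, P_returnEvent_ne_zero hp0 hp1 t, ?_⟩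
  · rw [measureReal_def, hret, ENNReal.toReal_mul, ENNReal.toReal_ofReal (Real.exp_pos _).le,
      measureReal_def]
  · ext A hA
    have hc0 : ENNReal.ofReal (Real.exp (-(2 * p - 1) * t)) ≠ 0 := by simp [Real.exp_pos]
    rw [bridgeLaw, bridgeLaw, Measure.map_apply (measurable_path _ t) hA,
      Measure.map_apply (measurable_path _ t) hA, cond_apply (measurableSet_returnEvent _ t),
      cond_apply (measurableSet_returnEvent _ t), P_returnEvent_inter hp0 hp1 t hA, hret,
      ← ENNReal.div_eq_inv_mul, ← ENNReal.div_eq_inv_mul,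
      ENNReal.mul_div_mul_left _ _ hc0 ENNReal.ofReal_ne_top]
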